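/- Let $F=\mathbb F_q$ be a finite field, $K\ge 1$, $N_r\le N$, $S\le N$, $M<N$ and $N_r-N+M\ge 1$. There are $N$ servers and $K$ mutually independent gradients $g_1,\dots,g_K$, each uniformly distributed on $F^L$; dataset $k$ is assigned to a set $\mathcal D_k$ of servers with $|\mathcal D_k|\ge M$. For each set $\mathcal V$ of exactly $S$ servers there is a finite-valued random key $Q_{\mathcal V}$ known to the servers in $\mathcal V$ only; all keys and gradients are mutually independent. A *secure scheme* for $(\mathcal D_k)_k$ consists of some $L\ge 1$, such gradients and keys, and messages $X_n\in F^{\ell_n}$ ($1\le n\le N$) such that (i) $H\big(X_n\mid (g_k)_{k:\,n\in\mathcal D_k},(Q_{\mathcal V})_{\mathcal V\ni n}\big)=0$ for all $n$; (ii) $H\big(\sum_k g_k\mid (X_n)_{n\in\mathcal U}\big)=0$ for all sets $\mathcal U$ of $N_r$ servers; (iii) $I\big(X_1,\dots,X_N;\,g_1,\dots,g_K\mid \sum_k g_k\big)=0$. Its cost is $\max_n \ell_n/L$. A *linear non-secure scheme* has no keys and no condition (iii): each $X_n\in F^{\ell_n}$ is an $F$-linear function of $(g_k)_{k:\,n\in\mathcal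 D_k}$, and any $N_r$ of the messages determine $\sum_k g_k$. Let $R^*$ (resp. $R_{\rm n}^*$) be the least cost that secure schemes (resp. linear non-secure schemes) achieve for every assignment with $|\mathcal D_k|\ge M$ for all $k$, and let $$R=\frac{\binom NS-\binom MS}{\big(\binom NS-\binom MS\big)N_r-\binom NS (N-M)}.$$ Then $R_{\rm n}^*=\frac1{N_r-N+M}$, and: 1. If $S>M$, then $R$ is achieved by secure schemes for every such assignment, and it is optimal: $R^*=R=R_{\rm n}^*=\frac{1}{N_r-N+M}$. 2. If $N-N_r+2\le S\le M$, then $R$ is achieved by secure schemes for every such assignment, and it is order optimal within a factor of $2$: every cost achieved by secure schemes for all such assignments is at least $R_{\rm n}^*$, and $R_{\rm n}^*\le R\le 2R_{\rm n}^*$. The formula for $R_{\rm n}^*$, the optimality of $R$ in 1, and the lower bound by $R_{\rm n}^*$ in 2 hold as well for the costs achieved for any single fixed assignment with $\min_k|\mathcal D_k|=M$. -/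

import Mathlib

open MeasureTheory ProbabilityTheory

noncomputable section

namespace GradientCoding

universe u

/-! Shannon entropies of random variables with finite alphabets. They are only ever required to
vanish, so the base of the logarithm is immaterial, and the natural logarithm is used. -/

/-- The Shannon entropy `H(X)`. -/
def entropy {Ω A : Type*} [MeasurableSpace Ω] [Fintype A] (μ : Measure Ω) (X : Ω → A) : ℝ :=
  ∑ a, Real.negMulLog (μ.real (X ⁻¹' {a}))

/-- The conditional entropy `H(X | Y) = H(X, Y) - H(Y)`. -/
def condEntropy {Ω A B : Type*} [MeasurableSpace Ω] [Fintype A] [Fintype B]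
    (μ : Measure Ω) (X : Ω → A) (Y : Ω → B) : ℝ :=
  entropy μ (fun ω => (X ω, Y ω)) - entropy μ Y

/-- The conditional mutual information `I(X; Y | Z) = H(X | Z) - H(X | Y, Z)`. -/
def condMutualInfo {Ω A B C : Type*} [MeasurableSpace Ω] [Fintype A] [Fintype B] [Fintype C]
    (μ : Measure Ω) (X : Ω → A) (Y : Ω → B) (Z : Ω → C) : ℝ :=
  condEntropy μ X Z - condEntropy μ X (fun ω => (Y ω, Z ω))

/-- The groups of exactly `S` out of `N` servers. -/
abbrev KeyGroup (N S : ℕ) : Type := {V : Finset (Fin N) // V.card = S}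

/-- A secure gradient coding scheme over the finite field `F` with uncoded groupwise keys, for `K`
datasets and `N` servers, dataset `k` being assigned to the set of servers `D k`, where the user
decodes from any `Nr` servers and every key is shared by exactly `S` servers. -/
structure SecureScheme (F : Type u) [Field F] [Fintype F] {K N : ℕ}
    (D : Fin K → Finset (Fin N)) (Nr S : ℕ) where
  /-- the underlying probability space -/
  Ω : Type u
  [mΩ : MeasurableSpace Ω]
  μ : Measure Ω
  [prob : IsProbabilityMeasure μ]
  /-- the number of symbols of a gradient -/
  L : ℕ
  L_pos : 0 < L
  /-- the gradients -/
  g : Fin K → Ω → (Fin L → F)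
  /-- the sizes of the alphabets of the keys -/
  a : KeyGroup N S → ℕ
  /-- the keys, one for each group of `S` servers -/
  Q : (V : KeyGroup N S) → Ω → Fin (a V)
  /-- the numbers of symbols of the messages -/
  len : Fin N → ℕ
  /-- the messages of the servers -/
  X : (n : Fin N) → Ω → (Fin (len n) → F)
  measurable_g : ∀ k x, MeasurableSet (g k ⁻¹' {x})
  measurable_Q : ∀ V x, MeasurableSet (Q V ⁻¹' {x})
  measurable_X : ∀ n x, MeasurableSet (X n ⁻¹' {x})
  /-- the gradients are uniformly distributed -/
  uniform_g : ∀ k x, μ.real (g k ⁻¹' {x}) = ((Fintype.card F : ℝ) ^ L)⁻¹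
  /-- all gradients and keys together are mutually independent: the gradients are, the keys are,
  and the family of all gradients is independent of the family of all keys -/
  indep_g : iIndepFun (m := fun _ => ⊤) g μ
  indep_Q : iIndepFun (m := fun _ => ⊤) Q μ
  indep_g_Q : @IndepFun Ω _ _ mΩ ⊤ ⊤ (fun ω k => g k ω) (fun ω V => Q V ω) μ
  /-- encoding: the message of server `n` is determined by the gradients of the datasets assigned
  to it and by the keys of the groups that contain it -/
  encodable : ∀ n, condEntropy μ (X n)
    (fun ω => (fun k : {k // n ∈ D k} => g k.1 ω,
      fun V : {V : KeyGroup N S // n ∈ V.1} => Q V.1 ω)) = 0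
  /-- decoding: the messages of any `Nr` servers determine the sum of the gradients -/
  decodable : ∀ U : Finset (Fin N), U.card = Nr →
    condEntropy μ (fun ω => ∑ k, g k ω) (fun ω (n : U) => X n.1 ω) = 0
  /-- security: all messages together reveal nothing about the gradients beyond their sum -/
  secure : condMutualInfo μ (fun ω n => X n ω) (fun ω k => g k ω) (fun ω => ∑ k, g k ω) = 0

/-- The communication cost: the largest message length, divided by the gradient length. -/
def SecureScheme.cost {F : Type u} [Field F] [Fintype F] {K N : ℕ}
    {D : Fin K → Finset (Fin N)} {Nr S : ℕ} (s : SecureScheme F D Nr S) : ℝ :=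
  ⨆ n : Fin N, (s.len n : ℝ) / s.L

/-- A linear gradient coding scheme without keys and without security constraint: the encoders are
`F`-linear, and the messages of any `Nr` servers determine the sum of the gradients. -/
structure LinearScheme (F : Type u) [Field F] {K N : ℕ}
    (D : Fin K → Finset (Fin N)) (Nr : ℕ) where
  /-- the number of symbols of a gradient -/
  L : ℕ
  L_pos : 0 < L
  /-- the numbers of symbols of the messages -/
  len : Fin N → ℕ
  /-- server `n` encodes the gradients of the datasets assigned to it -/
  enc : (n : Fin N) → ({k // n ∈ D k} → (Fin L → F)) →ₗ[F] (Fin (len n) → F)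
  decodable : ∀ U : Finset (Fin N), U.card = Nr →
    ∃ dec : ((n : U) → (Fin (len n.1) → F)) → (Fin L → F),
      ∀ g : Fin K → (Fin L → F), dec (fun n => enc n.1 (fun k => g k.1)) = ∑ k, g k

/-- The communication cost: the largest message length, divided by the gradient length. -/
def LinearScheme.cost {F : Type u} [Field F] {K N : ℕ}
    {D : Fin K → Finset (Fin N)} {Nr : ℕ} (s : LinearScheme F D Nr) : ℝ :=
  ⨆ n : Fin N, (s.len n : ℝ) / s.L

/-- The achievable costs of secure gradient coding for the data assignment `D`. -/
def secureCosts (F : Type u) [Field F] [Fintype F] {K N : ℕ}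
    (D : Fin K → Finset (Fin N)) (Nr S : ℕ) : Set ℝ :=
  {R | ∃ s : SecureScheme F D Nr S, s.cost = R}

/-- The achievable costs of linear non-secure gradient coding for the data assignment `D`. -/
def linearCosts (F : Type u) [Field F] {K N : ℕ}
    (D : Fin K → Finset (Fin N)) (Nr : ℕ) : Set ℝ :=
  {R | ∃ s : LinearScheme F D Nr, s.cost = R}

/-- The costs of secure gradient coding that are achievable for every data assignment in which
each of the `K` datasets is assigned to at least `M` of the `N` servers. -/
def modelSecureCosts (F : Type u) [Field F] [Fintype F] (K N Nr M S : ℕ) : Set ℝ :=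
  {R | ∀ D : Fin K → Finset (Fin N), (∀ k, M ≤ (D k).card) → R ∈ secureCosts F D Nr S}

/-- The costs of linear non-secure gradient coding that are achievable for every data assignment
in which each of the `K` datasets is assigned to at least `M` of the `N` servers. -/
def modelLinearCosts (F : Type u) [Field F] (K N Nr M : ℕ) : Set ℝ :=
  {R | ∀ D : Fin K → Finset (Fin N), (∀ k, M ≤ (D k).card) → R ∈ linearCosts F D Nr}

/-- The cost `(C(N,S) - C(M,S)) / ((C(N,S) - C(M,S)) Nr - C(N,S) (N - M))` of the scheme. -/
def achievableCost (N Nr M S : ℕ) : ℝ :=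
  ((N.choose S : ℝ) - M.choose S) /
    (((N.choose S : ℝ) - M.choose S) * Nr - (N.choose S : ℝ) * ((N : ℝ) - M))

end GradientCoding

end

/-!
The linear and the secure schemes have a common source. Put `r = N - M`, let `B = N.choose S` be the
number of key groups, and let `A = numMeeting N S r` be the number of groups that meet a given set
of `r` servers. Over a finite extension `E` of `F`, every server sends `A` symbols, every key has
`r` symbols and every gradient has `L = A * Nr - r * B` symbols. Server `n` sends
`s1 n (∑ g) + s2 n (Q + ∑ C k (g k))`, where the coefficients `s2 n` vanish at the keys unknown to
it and all other coefficients of `s1` and `s2` are generic (`Coefficients`).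

* Encoding: `C k` has to satisfy `s1 n + s2 n * C k = 0` for the servers `n` without dataset `k`.
  There are at most `r` of them, and the `A * r` symbols sent by `r` servers involve exactly the
  `A * r` symbols of the keys meeting them, so that this is a square system.
* Decoding: the messages of `Nr` servers are given by a square matrix in `∑ g` and the masked
  keys `Q + ∑ C k (g k)`, of size `L + r * B = A * Nr`.
* Security: the messages are functions of `∑ g` and of the masked keys, which are uniform and
  independent of the gradients (`mem_secureCosts`).

Each of these generic square matrices is invertible as soon as its support contains a perfect
matching (`exists_generic_matrix`). The matchings come from Hall's theorem
(`exists_matching_rows`, `exists_matching_columns`), whose condition is in both cases an instance of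
the convexity of `x ↦ x.choose S` (`choose_convex`). The cost of the scheme is `A / L`. With the
group of all servers as the only key group, and without keys, one obtains the linear schemes.

For the lower bound, fix the keys and all gradients other than `g k`. The sum of the gradients, and
hence `g k`, is then determined by the messages of those among `Nr` servers that have dataset `k`.
If `k` has exactly `M` servers, then the `Nr` servers can be chosen such that these are only
`Nr - N + M`, and counting values gives `L ≤ ∑ len n` over them. For secure schemes one passes from
vanishing entropies to functional dependence on outcomes of positive probability
(`eq_of_condEntropy_eq_zero`).
-/

namespace GradientCoding

open scoped Matrix

universe u

/-! ### Binomial estimates -/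

theorem choose_add_le (s a p : ℕ) :
    (a + p).choose (s + 1) ≤ a.choose (s + 1) + p * (a + p).choose s := by
  induction p with
  | zero => simp
  | succ p ih =>
    rw [← Nat.add_assoc, Nat.choose_succ_succ]
    have h : (a + p).choose s ≤ (a + p + 1).choose s := Nat.choose_le_choose _ (Nat.le_succ _)
    nlinarith [Nat.mul_le_mul_left p h]

theorem choose_add_ge (s a p : ℕ) :
    a.choose (s + 1) + p * a.choose s ≤ (a + p).choose (s + 1) := by
  induction p with
  | zero => simp
  | succ p ih =>
    rw [← Nat.add_assoc, Nat.choose_succ_succ]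
    have h : a.choose s ≤ (a + p).choose s := Nat.choose_le_choose _ (Nat.le_add_right _ _)
    nlinarith

/-- Discrete convexity of `x ↦ x.choose S`, at the points `a ≤ a + p ≤ a + p + q`. -/
theorem choose_convex {S : ℕ} (hS : 0 < S) (a p q : ℕ) :
    (p + q) * (a + p).choose S ≤ q * a.choose S + p * (a + p + q).choose S := by
  obtain ⟨s, rfl⟩ := Nat.exists_eq_succ_of_ne_zero hS.ne'
  have h1 := Nat.mul_le_mul_left q (choose_add_le s a p)
  have h2 := Nat.mul_le_mul_left p (choose_add_ge s (a + p) q)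
  simp only [Nat.succ_eq_add_one] at *
  nlinarith

/-- `x.choose S / ((x - d) * (x - d - 1))` does not decrease from `x = d + 1 + y` to `x + 1`, up to
clearing denominators. -/
theorem choose_step {S d : ℕ} (hS : d + 2 ≤ S) (y : ℕ) :
    (y + 2) * (d + 1 + y).choose S ≤ y * (d + 2 + y).choose S := by
  rcases lt_or_ge (d + 1 + y) S with h | h
  · simp [Nat.choose_eq_zero_of_lt h]
  · obtain ⟨z, hz⟩ := Nat.exists_eq_add_of_le h
    have e := Nat.choose_mul_succ_eq (d + 1 + y) S
    have e1 : d + 1 + y + 1 - S = z + 1 := by omega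
    have e2 : d + 1 + y + 1 = d + 2 + y := by omega
    rw [e1, e2] at e
    -- clearing `z + 1`, this is `(y + 2) (z + 1) ≤ y (d + 2 + y)`, where `z + 1 ≤ y`
    have hz' : (y + 2) * (z + 1) ≤ y * (d + 2 + y) := by nlinarith
    refine Nat.le_of_mul_le_mul_right (c := d + 2 + y) ?_ (by omega)
    calc (y + 2) * (d + 1 + y).choose S * (d + 2 + y)
        = (y + 2) * ((d + 1 + y).choose S * (d + 2 + y)) := by ring
      _ = ((y + 2) * (z + 1)) * (d + 2 + y).choose S := by rw [e]; ring
      _ ≤ (y * (d + 2 + y)) * (d + 2 + y).choose S := Nat.mul_le_mul_right _ hz'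
      _ = _ := by ring

/-- With `d = N - Nr`, `x = M - d - 1` and `p = N - M`, this bounds the fraction `C(M,S) / C(N,S)`
of the groups that avoid `N - M` given servers by
`(Nr - N + M) (Nr - N + M - 1) / (Nr (Nr - 1))`. -/
theorem choose_ratio {S d : ℕ} (hS : d + 2 ≤ S) (x p : ℕ) :
    (x + p + 1) * (x + p) * (d + 1 + x).choose S ≤
      (x + 1) * x * (d + 1 + (x + p)).choose S := by
  induction p with
  | zero => simp
  | succ p ih =>
    rcases Nat.eq_zero_or_pos x with rfl | hx
    · simp [Nat.choose_eq_zero_of_lt (show d + 1 < S by omega)]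
    · have h := choose_step hS (x + p)
      refine Nat.le_of_mul_le_mul_left (c := x + p) ?_ (by omega)
      have e : d + 1 + (x + (p + 1)) = d + 2 + (x + p) := by omega
      rw [e]
      calc (x + p) * ((x + (p + 1) + 1) * (x + (p + 1)) * (d + 1 + x).choose S)
          = (x + p + 2) * ((x + p + 1) * (x + p) * (d + 1 + x).choose S) := by ring
        _ ≤ (x + p + 2) * ((x + 1) * x * (d + 1 + (x + p)).choose S) := Nat.mul_le_mul_left _ ih
        _ = (x + 1) * x * ((x + p + 2) * (d + 1 + (x + p)).choose S) := by ring
        _ ≤ (x + 1) * x * ((x + p) * (d + 2 + (x + p)).choose S) := Nat.mul_le_mul_left _ h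
        _ = _ := by ring

/-- The number of groups of `S` servers that meet a given set of `r` servers. -/
def numMeeting (N S r : ℕ) : ℕ := N.choose S - (N - r).choose S

theorem numMeeting_add {N S r : ℕ} : numMeeting N S r + (N - r).choose S = N.choose S :=
  Nat.sub_add_cancel (Nat.choose_le_choose _ (Nat.sub_le _ _))

/-- `numMeeting N S t / t` decreases with `t`. -/
theorem numMeeting_mul_le {N S r t : ℕ} (hS : 0 < S) (hr : r ≤ N) (ht : t ≤ r) :
    t * numMeeting N S r ≤ r * numMeeting N S t := by
  obtain ⟨v, rfl⟩ := Nat.exists_eq_add_of_le ht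
  obtain ⟨a, rfl⟩ := Nat.exists_eq_add_of_le' hr
  have h := choose_convex hS a v t
  have h1 := @numMeeting_add (a + (t + v)) S (t + v)
  have h2 := @numMeeting_add (a + (t + v)) S t
  rw [show a + (t + v) - (t + v) = a by omega] at h1
  rw [show a + (t + v) - t = a + v by omega] at h2
  rw [show a + v + t = a + (t + v) by omega] at h
  nlinarith

/-- Hall's condition for the keys that, among `Nr` given servers, are known only to `t` of them:
there are at most `(N - Nr + t).choose S` such keys, and the `t` servers send
`t * numMeeting N S r` symbols. -/
theorem mul_choose_le {N Nr S r t : ℕ} (hNr : Nr ≤ N) (hS : N < Nr + S) (ht : t ≤ Nr)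
    (hr : r * N.choose S ≤ numMeeting N S r * Nr) :
    r * (N - Nr + t).choose S ≤ t * numMeeting N S r := by
  rcases Nat.eq_zero_or_pos Nr with rfl | hpos
  · obtain rfl : t = 0 := by omega
    simp [Nat.choose_eq_zero_of_lt (show N < S by omega)]
  obtain ⟨q, rfl⟩ := Nat.exists_eq_add_of_le ht
  obtain ⟨a, rfl⟩ := Nat.exists_eq_add_of_le' hNr
  have h := choose_convex (show 0 < S by omega) a t q
  rw [Nat.choose_eq_zero_of_lt (show a < S by omega), Nat.add_assoc] at h
  rw [show a + (t + q) - (t + q) = a by omega]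
  refine Nat.le_of_mul_le_mul_left (c := t + q) ?_ hpos
  calc (t + q) * (r * (a + t).choose S) = r * ((t + q) * (a + t).choose S) := by ring
    _ ≤ r * (t * (a + (t + q)).choose S) := Nat.mul_le_mul_left _ (by simpa using h)
    _ = t * (r * (a + (t + q)).choose S) := by ring
    _ ≤ t * (numMeeting (a + (t + q)) S r * (t + q)) := Nat.mul_le_mul_left _ hr
    _ = _ := by ring

/-! ### Matchings between message symbols and key symbols -/

theorem card_keyGroup_subset {N S : ℕ} (W : Finset (Fin N)) :
    (Finset.univ.filter fun V : KeyGroup N S => V.1 ⊆ W).card = W.card.choose S := by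
  rw [← Finset.card_powersetCard, ← Finset.card_map (Function.Embedding.subtype _)]
  congr 1
  ext V
  simp [Finset.mem_powersetCard, and_comm]

theorem card_keyGroup (N S : ℕ) : Fintype.card (KeyGroup N S) = N.choose S := by
  simp

theorem card_keyGroup_meeting {N S : ℕ} (T : Finset (Fin N)) :
    (Finset.univ.filter fun V : KeyGroup N S => ∃ n ∈ T, n ∈ V.1).card =
      numMeeting N S T.card := by
  have h1 := Finset.card_filter_add_card_filter_not (s := Finset.univ)
    (fun V : KeyGroup N S => V.1 ⊆ Tᶜ)
  rw [card_keyGroup_subset, Finset.card_univ, card_keyGroup, Finset.card_compl,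
    Fintype.card_fin] at h1
  have h2 : (Finset.univ.filter fun V : KeyGroup N S => ¬ V.1 ⊆ Tᶜ) =
      Finset.univ.filter fun V : KeyGroup N S => ∃ n ∈ T, n ∈ V.1 := by
    ext V
    simp [Finset.subset_iff, and_comm]
  rw [h2] at h1
  simp only [numMeeting]
  omega

/-- The symbols sent by any `r` servers can be matched to key symbols known to their senders, when
every server sends `numMeeting N S r` symbols and every key has `r` symbols. -/
theorem exists_matching_rows {N S r : ℕ} (hS : 0 < S) (T : Finset (Fin N)) (hT : T.card = r) :
    ∃ φ : T × Fin (numMeeting N S r) → KeyGroup N S × Fin r,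
      Function.Injective φ ∧ ∀ x, x.1.1 ∈ (φ x).1.1 := by
  classical
  let t : T × Fin (numMeeting N S r) → Finset (KeyGroup N S × Fin r) := fun x =>
    (Finset.univ.filter fun V : KeyGroup N S => x.1.1 ∈ V.1) ×ˢ Finset.univ
  suffices h : ∃ φ : T × Fin (numMeeting N S r) → KeyGroup N S × Fin r,
      Function.Injective φ ∧ ∀ x, φ x ∈ t x by
    obtain ⟨φ, h1, h2⟩ := h
    exact ⟨φ, h1, fun x => by simpa [t] using h2 x⟩
  rw [← Finset.all_card_le_biUnion_card_iff_exists_injective]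
  intro s
  let T' : Finset (Fin N) := s.image fun x => x.1.1
  have hT' : T' ⊆ T := by
    intro n hn
    obtain ⟨x, -, rfl⟩ := Finset.mem_image.1 hn
    exact x.1.2
  have hle : s.card ≤ T'.card * numMeeting N S r := by
    have hsub : s.card ≤ (T' ×ˢ (Finset.univ : Finset (Fin (numMeeting N S r)))).card := by
      refine Finset.card_le_card_of_injOn (fun x => (x.1.1, x.2)) ?_ ?_
      · intro x hx
        simp only [Finset.coe_product, Set.mem_prod, Finset.mem_coe, Finset.mem_univ, and_true]
        exact Finset.mem_image_of_mem _ hx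
      · intro x _ y _ hxy
        simp only [Prod.mk.injEq] at hxy
        exact Prod.ext (Subtype.ext hxy.1) hxy.2
    simpa [Finset.card_product] using hsub
  have hun : s.biUnion t =
      (Finset.univ.filter fun V : KeyGroup N S => ∃ n ∈ T', n ∈ V.1) ×ˢ Finset.univ := by
    ext ⟨V, j⟩
    simp only [t, T', Finset.mem_biUnion, Finset.mem_product, Finset.mem_filter, Finset.mem_univ,
      true_and, and_true, Finset.mem_image]
    constructor
    · rintro ⟨x, hx, hV⟩
      exact ⟨_, ⟨x, hx, rfl⟩, hV⟩
    · rintro ⟨_, ⟨x, hx, rfl⟩, hV⟩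
      exact ⟨x, hx, hV⟩
  rw [hun, Finset.card_product, card_keyGroup_meeting, Finset.card_univ, Fintype.card_fin]
  refine hle.trans ((numMeeting_mul_le hS ?_ ?_).trans_eq (Nat.mul_comm _ _))
  · simpa [hT] using Finset.card_le_univ T
  · exact hT ▸ Finset.card_le_card hT'

/-- All gradient and key symbols can be matched to the symbols sent by any `Nr` servers, a key
symbol only to a server that knows it. -/
theorem exists_matching_columns {N Nr S r L : ℕ} (hNr : Nr ≤ N) (hS : N < Nr + S)
    (hL : L + r * N.choose S = numMeeting N S r * Nr)
    (U : Finset (Fin N)) (hU : U.card = Nr) :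
    ∃ ψ : Fin L ⊕ (KeyGroup N S × Fin r) → U × Fin (numMeeting N S r),
      Function.Injective ψ ∧ ∀ x, (ψ (Sum.inr x)).1.1 ∈ x.1.1 := by
  classical
  let t : Fin L ⊕ (KeyGroup N S × Fin r) → Finset (U × Fin (numMeeting N S r)) :=
    Sum.elim (fun _ => Finset.univ)
      (fun x => (Finset.univ.filter fun n : U => n.1 ∈ x.1.1) ×ˢ Finset.univ)
  suffices h : ∃ ψ : Fin L ⊕ (KeyGroup N S × Fin r) → U × Fin (numMeeting N S r),
      Function.Injective ψ ∧ ∀ x, ψ x ∈ t x by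
    obtain ⟨ψ, h1, h2⟩ := h
    exact ⟨ψ, h1, fun x => by simpa [t] using h2 (Sum.inr x)⟩
  rw [← Finset.all_card_le_biUnion_card_iff_exists_injective]
  intro s
  by_cases hs : ∃ l, Sum.inl l ∈ s
  · obtain ⟨l, hl⟩ := hs
    have h1 : s.card ≤ L + r * N.choose S := by
      refine (Finset.card_le_univ s).trans_eq ?_
      simp [Nat.mul_comm]
    have h2 : s.biUnion t = Finset.univ :=
      Finset.eq_univ_of_forall fun x => Finset.mem_biUnion.2 ⟨_, hl, by simp [t]⟩
    rw [h2]
    simpa [hU, Nat.mul_comm Nr] using h1.trans_eq hL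
  · push Not at hs
    -- the servers that know some key symbol in `s`
    let W : Finset (Fin N) :=
      Finset.univ.filter fun n => ∃ x : KeyGroup N S × Fin r, Sum.inr x ∈ s ∧ n ∈ x.1.1
    have h1 : s.card ≤ W.card.choose S * r := by
      have hsub : s ⊆ ((Finset.univ.filter fun V : KeyGroup N S => V.1 ⊆ W) ×ˢ
          (Finset.univ : Finset (Fin r))).map Function.Embedding.inr := by
        rintro (l | x) hx
        · exact absurd hx (hs l)
        · simp only [Finset.mem_map, Finset.mem_product, Finset.mem_filter, Finset.mem_univ,
            true_and, and_true]
          exact ⟨x, fun n hn => by simpa [W] using ⟨x.1.1, ⟨x.1.2, x.2, hx⟩, hn⟩, rfl⟩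
      refine (Finset.card_le_card hsub).trans_eq ?_
      rw [Finset.card_map, Finset.card_product, card_keyGroup_subset, Finset.card_univ,
        Fintype.card_fin]
    have h2 : s.biUnion t = (Finset.univ.filter fun n : U => n.1 ∈ W) ×ˢ Finset.univ := by
      ext ⟨n, i⟩
      simp only [W, Finset.mem_biUnion, Finset.mem_product, Finset.mem_filter, Finset.mem_univ,
        true_and, and_true]
      constructor
      · rintro ⟨l | x, hx, hn⟩
        · exact absurd hx (hs l)
        · exact ⟨x, hx, by simpa [t] using hn⟩
      · rintro ⟨x, hx, hn⟩
        exact ⟨_, hx, by simpa [t] using hn⟩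
    have h3 : (Finset.univ.filter fun n : U => n.1 ∈ W).card = (U ∩ W).card := by
      rw [← Finset.card_map (Function.Embedding.subtype _)]
      congr 1
      ext n
      simp [and_comm]
    rw [h2, Finset.card_product, h3, Finset.card_univ, Fintype.card_fin]
    have h4 : W.card ≤ N - Nr + (U ∩ W).card := by
      have hW : W.card ≤ (Uᶜ ∪ (U ∩ W)).card := by
        refine Finset.card_le_card fun n hn => ?_
        by_cases hnU : n ∈ U <;> simp [hnU, hn]
      refine hW.trans ((Finset.card_union_le _ _).trans_eq ?_)
      rw [Finset.card_compl, Fintype.card_fin, hU]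
    calc s.card ≤ W.card.choose S * r := h1
      _ ≤ (N - Nr + (U ∩ W).card).choose S * r :=
          Nat.mul_le_mul_right _ (Nat.choose_le_choose _ h4)
      _ = r * (N - Nr + (U ∩ W).card).choose S := Nat.mul_comm _ _
      _ ≤ _ := mul_choose_le hNr hS (hU ▸ Finset.card_le_card Finset.inter_subset_left) (by omega)

/-! ### Generic matrices with prescribed zeros -/

/-- A nonzero polynomial over an arbitrary field does not vanish identically over a suitable finite
extension. -/
theorem exists_finite_extension_aeval_ne_zero {F : Type*} [Field F] {σ : Type*} [Finite σ]
    {P : MvPolynomial σ F} (hP : P ≠ 0) :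
    ∃ E : IntermediateField F (AlgebraicClosure F), FiniteDimensional F E ∧
      ∃ a : σ → E, MvPolynomial.aeval a P ≠ 0 := by
  obtain ⟨a, ha⟩ : ∃ a : σ → AlgebraicClosure F, MvPolynomial.aeval a P ≠ 0 := by
    by_contra! h
    refine hP (MvPolynomial.map_injective _ (algebraMap F (AlgebraicClosure F)).injective ?_)
    refine MvPolynomial.funext fun a => ?_
    rw [MvPolynomial.eval_map, ← MvPolynomial.aeval_def, h a]
    simp
  refine ⟨IntermediateField.adjoin F (Set.range a), ?_,
    fun i => ⟨a i, IntermediateField.subset_adjoin _ _ ⟨i, rfl⟩⟩, fun h => ha ?_⟩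
  · exact IntermediateField.finiteDimensional_adjoin fun x _ => Algebra.IsIntegral.isIntegral x
  · have h' := congrArg (algebraMap _ (AlgebraicClosure F)) h
    rwa [← MvPolynomial.aeval_algebraMap_apply, map_zero] at h'

/-- A partial transversal: a system of pairwise distinct rows and as many pairwise distinct columns,
with the entries `(row i, col i)` among the `allowed` ones. -/
structure Transversal {R C : Type*} (allowed : R → C → Prop) where
  ι : Type
  [fin : Fintype ι]
  [dec : DecidableEq ι]
  row : ι → R
  col : ι → C
  row_injective : Function.Injective row
  col_injective : Function.Injective col
  mem : ∀ i, allowed (row i) (col i)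

attribute [instance] Transversal.fin Transversal.dec

/-- Over some finite extension there is a matrix supported on the allowed entries, such that the
minors belonging to finitely many partial transversals are all nonzero. -/
theorem exists_generic_matrix {F : Type*} [Field F] {R C : Type*} [Finite R] [Finite C]
    {allowed : R → C → Prop} {J : Type*} [Fintype J] (t : J → Transversal allowed) :
    ∃ E : IntermediateField F (AlgebraicClosure F), FiniteDimensional F E ∧
      ∃ m : Matrix R C E, (∀ x y, ¬ allowed x y → m x y = 0) ∧
        ∀ j, (m.submatrix (t j).row (t j).col).det ≠ 0 := by
  classical
  -- the matrix of indeterminates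
  let G : Matrix R C (MvPolynomial (R × C) F) :=
    Matrix.of fun x y => if allowed x y then MvPolynomial.X (x, y) else 0
  have hdet : ∀ j, (G.submatrix (t j).row (t j).col).det ≠ 0 := by
    intro j h
    -- the indicator function of the transversal turns the submatrix into the identity
    let v : R × C → F := fun p => if ∃ i, p = ((t j).row i, (t j).col i) then 1 else 0
    have hv : (G.submatrix (t j).row (t j).col).map (MvPolynomial.eval v) = 1 := by
      ext i i'
      by_cases hi : i = i'
      · subst hi
        have : ∃ l, (t j).row i = (t j).row l ∧ (t j).col i = (t j).col l := ⟨i, rfl, rfl⟩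
        simp [G, v, (t j).mem, this]
      · have : ¬ ∃ l, (t j).row i = (t j).row l ∧ (t j).col i' = (t j).col l := by
          rintro ⟨l, h1, h2⟩
          exact hi (((t j).row_injective h1).trans ((t j).col_injective h2).symm)
        rw [Matrix.one_apply_ne hi]
        simp only [Matrix.map_apply, Matrix.submatrix_apply, G, Matrix.of_apply]
        split_ifs
        · simp [v, this]
        · simp
    have h2 := congrArg (MvPolynomial.eval v) h
    rw [RingHom.map_det, RingHom.mapMatrix_apply, hv, Matrix.det_one, map_zero] at h2
    exact one_ne_zero h2
  obtain ⟨E, hE, a, ha⟩ := exists_finite_extension_aeval_ne_zero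
    (Finset.prod_ne_zero_iff.2 fun j (_ : j ∈ Finset.univ) => hdet j)
  refine ⟨E, hE, G.map (MvPolynomial.aeval a), fun x y hxy => by simp [G, hxy], fun j h => ha ?_⟩
  rw [map_prod]
  refine Finset.prod_eq_zero (Finset.mem_univ j) ?_
  rw [← AlgHom.coe_toRingHom, RingHom.map_det]
  exact h

/-- The coefficients of a scheme with `A` symbols per message, `L` symbols per gradient and `r`
symbols per key, over the field `E`. The messages are linear functions, with coefficients `s1` and
`s2`, of the sum of the gradients and of masked keys; the latter are sums of the keys and of linear
functions of the gradients, with coefficients `C`. -/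
structure Coefficients (E : Type*) [Field E] {K N : ℕ} (D : Fin K → Finset (Fin N))
    (Nr S r A L : ℕ) where
  s1 : Fin N → Matrix (Fin A) (Fin L) E
  s2 : Fin N → Matrix (Fin A) (KeyGroup N S × Fin r) E
  C : Fin K → Matrix (KeyGroup N S × Fin r) (Fin L) E
  /-- a server uses only the keys that it knows -/
  support : ∀ n i x, n ∉ x.1.1 → s2 n i x = 0
  /-- the contributions of a gradient cancel at the servers to which it is not assigned -/
  cancel : ∀ k n, n ∉ D k → s1 n + s2 n * C k = 0
  /-- any `Nr` messages determine the sum of the gradients -/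
  decode : ∀ U : Finset (Fin N), U.card = Nr →
    ∀ (w : Fin L → E) (z : KeyGroup N S × Fin r → E),
    (∀ n ∈ U, s1 n *ᵥ w + s2 n *ᵥ z = 0) → w = 0

/-- A system of linear equations whose coefficient matrix has an invertible square submatrix
comprising all rows is solvable. -/
theorem exists_solution {E ι C : Type*} [Field E] [Fintype ι] [DecidableEq ι] [Fintype C]
    (m : ι → C → E) (φ : ι → C)
    (h : (Matrix.of fun i j => m i (φ j)).det ≠ 0) (b : ι → E) :
    ∃ z : C → E, ∀ i, ∑ x, m i x * z x = b i := by
  classical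
  obtain ⟨y, hy⟩ := (Matrix.mulVec_surjective_iff_isUnit.2
    ((Matrix.isUnit_iff_isUnit_det _).2 (isUnit_iff_ne_zero.2 h))) b
  refine ⟨fun x => ∑ j, if φ j = x then y j else 0, fun i => ?_⟩
  rw [← congrFun hy i]
  simp only [Matrix.mulVec, dotProduct, Matrix.of_apply, Finset.mul_sum]
  rw [Finset.sum_comm]
  refine Finset.sum_congr rfl fun j _ => ?_
  simp

theorem exists_coefficients (F : Type*) [Field F] {K N Nr S r L : ℕ} (D : Fin K → Finset (Fin N))
    (hNr : Nr ≤ N) (hr : r ≤ N) (hS : N < Nr + S)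
    (hL : L + r * N.choose S = numMeeting N S r * Nr) (hD : ∀ k, N ≤ (D k).card + r) :
    ∃ E : IntermediateField F (AlgebraicClosure F), FiniteDimensional F E ∧
      Nonempty (Coefficients E D Nr S r (numMeeting N S r) L) := by
  classical
  have hS0 : 0 < S := by omega
  let allowed : Fin N × Fin (numMeeting N S r) → Fin L ⊕ (KeyGroup N S × Fin r) → Prop :=
    fun y x => ∀ p, x = Sum.inr p → y.1 ∈ p.1.1
  choose φ hφ hφm using fun T : {T : Finset (Fin N) // T.card = r} =>
    exists_matching_rows hS0 T.1 T.2
  choose ψ hψ hψm using fun U : {U : Finset (Fin N) // U.card = Nr} =>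
    exists_matching_columns hNr hS hL U.1 U.2
  let t : {T : Finset (Fin N) // T.card = r} ⊕ {U : Finset (Fin N) // U.card = Nr} →
      Transversal allowed := Sum.elim
    (fun T =>
      { ι := T.1 × Fin (numMeeting N S r)
        row := fun x => (x.1.1, x.2)
        col := fun x => Sum.inr (φ T x)
        row_injective := fun x y h => by
          simp only [Prod.mk.injEq] at h
          exact Prod.ext (Subtype.ext h.1) h.2
        col_injective := Sum.inr_injective.comp (hφ T)
        mem := fun x p h => by
          obtain rfl := Sum.inr_injective h
          exact hφm T x })
    (fun U =>
      { ι := Fin L ⊕ (KeyGroup N S × Fin r)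
        row := fun x => ((ψ U x).1.1, (ψ U x).2)
        col := id
        row_injective := fun x y h => by
          simp only [Prod.mk.injEq] at h
          exact hψ U (Prod.ext (Subtype.ext h.1) h.2)
        col_injective := Function.injective_id
        mem := fun x p h => by
          obtain rfl : x = Sum.inr p := h
          exact hψm U p })
  obtain ⟨E, hE, m, hm0, hm⟩ := exists_generic_matrix (F := F) t
  -- enlarge the set of servers lacking dataset `k` to one of size `r`
  have hT : ∀ k, ∃ T : Finset (Fin N), (D k)ᶜ ⊆ T ∧ T.card = r := fun k => by
    refine Finset.exists_superset_card_eq ?_ (by simpa using hr)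
    have := hD k
    rw [Finset.card_compl, Fintype.card_fin]
    omega
  choose T hDT hTr using hT
  have hC : ∀ k l, ∃ z : KeyGroup N S × Fin r → E, ∀ y : T k × Fin (numMeeting N S r),
      ∑ x, m (y.1.1, y.2) (Sum.inr x) * z x = - m (y.1.1, y.2) (Sum.inl l) := fun k l =>
    exists_solution (fun (y : T k × Fin (numMeeting N S r)) x => m (y.1.1, y.2) (Sum.inr x))
      (φ ⟨T k, hTr k⟩) (hm (Sum.inl ⟨T k, hTr k⟩)) _
  choose C hC using hC
  refine ⟨E, hE, ⟨{
    s1 := fun n => Matrix.of fun i l => m (n, i) (Sum.inl l)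
    s2 := fun n => Matrix.of fun i x => m (n, i) (Sum.inr x)
    C := fun k => Matrix.of fun x l => C k l x
    support := fun n i x h => hm0 _ _ fun h' => h (h' x rfl)
    cancel := fun k n hn => ?_
    decode := fun U hU w z h => ?_ }⟩⟩
  · ext i l
    have h := hC k l (⟨n, hDT k (by simpa using hn)⟩, i)
    simp only [Matrix.add_apply, Matrix.mul_apply, Matrix.of_apply, Matrix.zero_apply]
    rw [h, add_neg_cancel]
  · have h0 := Matrix.eq_zero_of_mulVec_eq_zero (hm (Sum.inr ⟨U, hU⟩)) (v := Sum.elim w z) (by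
      funext x
      have h1 := congrFun (h (ψ ⟨U, hU⟩ x).1.1 (ψ ⟨U, hU⟩ x).1.2) (ψ ⟨U, hU⟩ x).2
      change ∑ y : Fin L ⊕ (KeyGroup N S × Fin r),
        m ((ψ ⟨U, hU⟩ x).1.1, (ψ ⟨U, hU⟩ x).2) y * Sum.elim w z y = 0
      rw [Fintype.sum_sum_type]
      exact h1)
    funext l
    exact congrFun h0 (Sum.inl l)

/-! ### Vanishing entropies -/

section Entropy

variable {Ω A B C : Type*} [MeasurableSpace Ω] {μ : Measure Ω}

theorem measurableSet_preimage_pair {X : Ω → A} {Y : Ω → B}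
    (hX : ∀ x, MeasurableSet (X ⁻¹' {x})) (hY : ∀ y, MeasurableSet (Y ⁻¹' {y})) (p : A × B) :
    MeasurableSet ((fun ω => (X ω, Y ω)) ⁻¹' {p}) := by
  convert (hX p.1).inter (hY p.2) using 1
  ext ω
  simp [Prod.ext_iff]

theorem measurableSet_preimage_pi {ι : Type*} [Countable ι] {α : ι → Type*}
    {X : ∀ i, Ω → α i} (hX : ∀ i x, MeasurableSet (X i ⁻¹' {x})) (x : ∀ i, α i) :
    MeasurableSet ((fun ω i => X i ω) ⁻¹' {x}) := by
  convert MeasurableSet.iInter fun i => hX i (x i) using 1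
  ext ω
  simp [funext_iff]

theorem measurableSet_preimage_comp [Finite A] {X : Ω → A}
    (hX : ∀ x, MeasurableSet (X ⁻¹' {x})) (f : A → B) (y : B) :
    MeasurableSet ((fun ω => f (X ω)) ⁻¹' {y}) := by
  have h : (fun ω => f (X ω)) ⁻¹' {y} = ⋃ x ∈ f ⁻¹' {y}, X ⁻¹' {x} := by
    ext ω
    simp
  rw [h]
  exact MeasurableSet.biUnion (Set.to_countable _) fun x _ => hX x

/-- The marginal distribution of `Y`. -/
theorem sum_measureReal_pair [IsFiniteMeasure μ] [Fintype A] {X : Ω → A} {Y : Ω → B}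
    (hX : ∀ x, MeasurableSet (X ⁻¹' {x})) (hY : ∀ y, MeasurableSet (Y ⁻¹' {y})) (y : B) :
    ∑ x, μ.real ((fun ω => (X ω, Y ω)) ⁻¹' {(x, y)}) = μ.real (Y ⁻¹' {y}) := by
  have h : Y ⁻¹' {y} = ⋃ x ∈ (Finset.univ : Finset A), (fun ω => (X ω, Y ω)) ⁻¹' {(x, y)} := by
    ext ω
    simp
  rw [h, measureReal_biUnion_finset]
  · intro x _ x' _ hxx'
    refine Set.disjoint_left.2 fun ω h1 h2 => hxx' ?_
    simp only [Set.mem_preimage, Set.mem_singleton_iff, Prod.mk.injEq] at h1 h2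
    exact h1.1.symm.trans h2.1
  · exact fun x _ => measurableSet_preimage_pair hX hY _

theorem condEntropy_eq_zero_of_factorsThrough [Fintype A] [Nonempty A] [Fintype B] {X : Ω → A}
    {Y : Ω → B} (h : Function.FactorsThrough X Y) : condEntropy μ X Y = 0 := by
  classical
  obtain ⟨f, rfl⟩ := (Function.factorsThrough_iff X).1 h
  change condEntropy μ (fun ω => f (Y ω)) Y = 0
  rw [condEntropy, entropy, entropy, Fintype.sum_prod_type_right, sub_eq_zero]
  refine Finset.sum_congr rfl fun y _ => ?_
  rw [Finset.sum_eq_single (f y)]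
  · congr 2
    ext ω
    simp only [Set.mem_preimage, Set.mem_singleton_iff, Prod.mk.injEq]
    exact ⟨fun h => h.2, fun h => ⟨by rw [h], h⟩⟩
  · intro x _ hx
    have h : (fun ω => (f (Y ω), Y ω)) ⁻¹' {(x, y)} = ∅ := by
      ext ω
      simp only [Set.mem_preimage, Set.mem_singleton_iff, Prod.mk.injEq, Set.mem_empty_iff_false,
        iff_false, not_and]
      rintro h1 rfl
      exact hx h1.symm
    rw [h]
    simp
  · simp

/-- If `H(X | Y) = 0`, then any two outcomes of positive probability that agree on `Y` agree
on `X`. -/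
theorem eq_of_condEntropy_eq_zero [IsProbabilityMeasure μ] [Fintype A] [Fintype B]
    {X : Ω → A} {Y : Ω → B} (hX : ∀ x, MeasurableSet (X ⁻¹' {x}))
    (hY : ∀ y, MeasurableSet (Y ⁻¹' {y})) (h : condEntropy μ X Y = 0) {x x' : A} {y : B}
    (hx : μ.real ((fun ω => (X ω, Y ω)) ⁻¹' {(x, y)}) ≠ 0)
    (hx' : μ.real ((fun ω => (X ω, Y ω)) ⁻¹' {(x', y)}) ≠ 0) : x = x' := by
  classical
  set p : A → B → ℝ := fun x y => μ.real ((fun ω => (X ω, Y ω)) ⁻¹' {(x, y)}) with hp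
  set q : B → ℝ := fun y => μ.real (Y ⁻¹' {y}) with hq
  have hpq : ∀ y, ∑ x, p x y = q y := fun y => sum_measureReal_pair hX hY y
  have hp0 : ∀ x y, 0 ≤ p x y := fun x y => measureReal_nonneg
  have hle : ∀ x y, p x y ≤ q y := fun x y => by
    rw [← hpq y]
    exact Finset.single_le_sum (f := fun x => p x y) (fun x _ => hp0 x y) (Finset.mem_univ x)
  have hterm : ∀ x y, 0 ≤ p x y * (Real.log (q y) - Real.log (p x y)) := fun x y => by
    rcases (hp0 x y).eq_or_lt with h0 | h0
    · simp [← h0]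
    · exact mul_nonneg h0.le (sub_nonneg.2 (Real.log_le_log h0 (hle x y)))
  -- the conditional entropy is a sum of nonnegative terms
  have hsum : ∑ y, ∑ x, p x y * (Real.log (q y) - Real.log (p x y)) = 0 := by
    rw [← h, condEntropy, entropy, entropy, Fintype.sum_prod_type_right, ← Finset.sum_sub_distrib]
    refine Finset.sum_congr rfl fun y _ => ?_
    have : Real.negMulLog (μ.real (Y ⁻¹' {y})) = - ∑ x, p x y * Real.log (q y) := by
      rw [← Finset.sum_mul, hpq y, Real.negMulLog]
      ring
    rw [this, sub_neg_eq_add, ← Finset.sum_add_distrib]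
    refine Finset.sum_congr rfl fun x _ => ?_
    simp only [Real.negMulLog, p]
    ring
  have hzero : ∀ x, p x y * (Real.log (q y) - Real.log (p x y)) = 0 := fun x => by
    have h1 := (Finset.sum_eq_zero_iff_of_nonneg
      fun y _ => Finset.sum_nonneg fun x _ => hterm x y).1 hsum y (Finset.mem_univ _)
    exact (Finset.sum_eq_zero_iff_of_nonneg fun x _ => hterm x y).1 h1 x (Finset.mem_univ _)
  have heq : ∀ x, p x y ≠ 0 → p x y = q y := fun x hx => by
    have hpos : 0 < p x y := (hp0 x y).lt_of_ne' hx
    have := (mul_eq_zero.1 (hzero x)).resolve_left hx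
    exact Real.log_injOn_pos hpos (hpos.trans_le (hle x y)) (sub_eq_zero.1 this).symm
  by_contra hne
  have h2 : p x y + p x' y ≤ q y := by
    rw [← hpq y, ← Finset.sum_pair (f := fun x => p x y) hne]
    exact Finset.sum_le_sum_of_subset_of_nonneg (Finset.subset_univ _) fun z _ _ => hp0 z y
  rw [heq x hx, heq x' hx'] at h2
  have h3 : 0 < q y := ((hp0 x y).lt_of_ne' hx).trans_le (hle x y)
  linarith

/-- `I(X; Y | Z) = 0` if a transition kernel `κ` from `Z` gives the distribution of `X`
conditioned on `Y` and `Z`. -/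
theorem condMutualInfo_eq_zero [IsProbabilityMeasure μ] [Fintype A] [Fintype B] [Fintype C]
    {X : Ω → A} {Y : Ω → B} {Z : Ω → C} (hX : ∀ x, MeasurableSet (X ⁻¹' {x}))
    (hY : ∀ y, MeasurableSet (Y ⁻¹' {y})) (hZ : ∀ z, MeasurableSet (Z ⁻¹' {z}))
    (κ : C → A → ℝ) (hκ : ∀ z, ∑ x, κ z x = 1)
    (h : ∀ x y z, μ.real ((fun ω => (X ω, Y ω, Z ω)) ⁻¹' {(x, y, z)}) =
      μ.real ((fun ω => (Y ω, Z ω)) ⁻¹' {(y, z)}) * κ z x) :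
    condMutualInfo μ X Y Z = 0 := by
  have hXZ : ∀ x z, μ.real ((fun ω => (X ω, Z ω)) ⁻¹' {(x, z)}) =
      μ.real (Z ⁻¹' {z}) * κ z x := fun x z => by
    rw [← sum_measureReal_pair hY (measurableSet_preimage_pair hX hZ), ←
      sum_measureReal_pair hY hZ, Finset.sum_mul]
    refine Finset.sum_congr rfl fun y _ => ?_
    rw [← h]
    congr 1
    ext ω
    simp only [Set.mem_preimage, Set.mem_singleton_iff, Prod.mk.injEq]
    tauto
  -- the chain rule `H(X, W) = H(W) + E[H(κ)]`, for `W = Z` and for `W = (Y, Z)`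
  have h1 : condEntropy μ X Z = ∑ z, μ.real (Z ⁻¹' {z}) * ∑ x, Real.negMulLog (κ z x) := by
    rw [condEntropy, entropy, entropy, Fintype.sum_prod_type_right, ← Finset.sum_sub_distrib]
    refine Finset.sum_congr rfl fun z _ => ?_
    simp only [hXZ, Real.negMulLog_mul, Finset.sum_add_distrib]
    rw [← Finset.sum_mul, hκ, ← Finset.mul_sum]
    ring
  have h2 : condEntropy μ X (fun ω => (Y ω, Z ω)) =
      ∑ z, μ.real (Z ⁻¹' {z}) * ∑ x, Real.negMulLog (κ z x) := by
    rw [condEntropy, entropy, entropy, Fintype.sum_prod_type_right, ← Finset.sum_sub_distrib,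
      Fintype.sum_prod_type_right]
    refine Finset.sum_congr rfl fun z _ => ?_
    rw [← sum_measureReal_pair hY hZ z, Finset.sum_mul]
    refine Finset.sum_congr rfl fun y _ => ?_
    simp only [h, Real.negMulLog_mul, Finset.sum_add_distrib]
    rw [← Finset.sum_mul, hκ, ← Finset.mul_sum]
    ring
  rw [condMutualInfo, h1, h2, sub_self]

end Entropy

/-! ### Lower bounds -/

theorem one_div_card_le_iSup {N L : ℕ} (hL : 0 < L) (len : Fin N → ℕ) (W : Finset (Fin N))
    (h : L ≤ ∑ n ∈ W, len n) : 1 / (W.card : ℝ) ≤ ⨆ n, (len n : ℝ) / L := by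
  have hL' : (0 : ℝ) < L := by exact_mod_cast hL
  have h1 : (1 : ℝ) ≤ W.card * ⨆ n, (len n : ℝ) / L := by
    calc (1 : ℝ) = L / L := (div_self hL'.ne').symm
      _ ≤ (∑ n ∈ W, len n : ℕ) / L := by gcongr
      _ = ∑ n ∈ W, (len n : ℝ) / L := by rw [Nat.cast_sum, Finset.sum_div]
      _ ≤ ∑ _n ∈ W, ⨆ n, (len n : ℝ) / L :=
          Finset.sum_le_sum fun n _ =>
            le_ciSup (f := fun n => (len n : ℝ) / L) (Set.finite_range _).bddAbove n
      _ = _ := by rw [Finset.sum_const, nsmul_eq_mul]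
  rcases Nat.eq_zero_or_pos W.card with h0 | h0
  · rw [h0] at h1
    norm_num at h1
  · rw [div_le_iff₀ (by exact_mod_cast h0), mul_comm]
    exact h1

/-- Some `Nr` servers include all servers without a given dataset, hence only `Nr - N + M` servers
that have it. -/
theorem exists_users {N Nr M : ℕ} (D : Finset (Fin N)) (hNr : Nr ≤ N) (hM : N < Nr + M)
    (hD : D.card = M) : ∃ U : Finset (Fin N), U.card = Nr ∧ (U ∩ D).card = Nr + M - N := by
  have h1 : Dᶜ.card = N - M := by rw [Finset.card_compl, Fintype.card_fin, hD]
  obtain ⟨U, hU, hUc⟩ := Finset.exists_superset_card_eq (s := Dᶜ) (n := Nr) (by omega) (by simpa)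
  refine ⟨U, hUc, ?_⟩
  have h2 : U ∩ D = U \ Dᶜ := by
    ext n
    simp
  have h3 : D.card ≤ N := by simpa using Finset.card_le_univ D
  rw [h2, Finset.card_sdiff_of_subset hU]
  omega

theorem le_sum_of_injective {F : Type*} [Fintype F] [Nontrivial F] {N L : ℕ} {len : Fin N → ℕ}
    {W : Finset (Fin N)} (f : (Fin L → F) → (n : W) → Fin (len n) → F)
    (hf : Function.Injective f) : L ≤ ∑ n ∈ W, len n := by
  classical
  have h := Fintype.card_le_of_injective f hf
  simp only [Fintype.card_pi, Finset.prod_const, Finset.card_univ, Fintype.card_fin,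
    Finset.prod_pow_eq_pow_sum] at h
  rw [Finset.sum_coe_sort W len] at h
  exact (Nat.pow_le_pow_iff_right Fintype.one_lt_card).1 h

/-- With all other gradients set to zero, the messages of the servers in `U` that have
dataset `k` determine the gradient `g k`. -/
theorem LinearScheme.L_le {F : Type*} [Field F] [Fintype F] {K N Nr : ℕ}
    {D : Fin K → Finset (Fin N)} (s : LinearScheme F D Nr) (k : Fin K) (U : Finset (Fin N))
    (hU : U.card = Nr) : s.L ≤ ∑ n ∈ U ∩ D k, s.len n := by
  classical
  refine le_sum_of_injective (F := F)
    (fun v n => s.enc n.1 fun k' => (Pi.single k v : Fin K → Fin s.L → F) k'.1) fun v v' h => ?_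
  obtain ⟨dec, hdec⟩ := s.decodable U hU
  have h1 : ∀ v : Fin s.L → F, ∑ k', (Pi.single k v : Fin K → Fin s.L → F) k' = v := fun v => by
    simp
  rw [← h1 v, ← h1 v', ← hdec, ← hdec]
  congr 1
  funext n
  by_cases hn : n.1 ∈ D k
  · exact congrFun h ⟨n.1, Finset.mem_inter.2 ⟨n.2, hn⟩⟩
  · congr 1
    funext k'
    have hk : k'.1 ≠ k := fun h => hn (h ▸ k'.2)
    simp [hk]

theorem exists_measureReal_ne_zero {Ω A : Type*} [MeasurableSpace Ω] {μ : Measure Ω}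
    [IsFiniteMeasure μ] [Fintype A] (X : Ω → A) {s : Set Ω} (hs : μ.real s ≠ 0) :
    ∃ x, μ.real (s ∩ X ⁻¹' {x}) ≠ 0 := by
  by_contra! h
  refine hs (le_antisymm ?_ measureReal_nonneg)
  calc μ.real s = μ.real (⋃ x ∈ (Finset.univ : Finset A), s ∩ X ⁻¹' {x}) := by
        congr 1
        ext ω
        simp
    _ ≤ ∑ x, μ.real (s ∩ X ⁻¹' {x}) := measureReal_biUnion_finset_le _ _
    _ = 0 := Finset.sum_eq_zero fun x _ => h x

/-- Conditioned on a fixed value of the keys and of all other gradients, the messages of the servers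
in `U` that have dataset `k` determine the gradient `g k`. -/
theorem SecureScheme.L_le {F : Type*} [Field F] [Fintype F] {K N Nr S : ℕ}
    {D : Fin K → Finset (Fin N)} (s : SecureScheme F D Nr S) (k : Fin K) (U : Finset (Fin N))
    (hU : U.card = Nr) : s.L ≤ ∑ n ∈ U ∩ D k, s.len n := by
  classical
  let _ := s.mΩ
  have _ := s.prob
  obtain ⟨κ, hκ⟩ := exists_measureReal_ne_zero (μ := s.μ) (fun ω V => s.Q V ω) (s := Set.univ)
    (by simp)
  rw [Set.univ_inter] at hκ
  have hg : ∀ γ : Fin K → Fin s.L → F, s.μ.real ((fun ω k => s.g k ω) ⁻¹' {γ}) ≠ 0 := fun γ => by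
    have h1 : (fun ω k => s.g k ω) ⁻¹' {γ} =
        ⋂ k ∈ (Finset.univ : Finset (Fin K)), s.g k ⁻¹' {γ k} := by
      ext ω
      simp [funext_iff]
    rw [h1, measureReal_def, s.indep_g.measure_inter_preimage_eq_mul Finset.univ
      (sets := fun k => {γ k}) (fun k _ => trivial), ENNReal.toReal_prod]
    refine Finset.prod_ne_zero_iff.2 fun k _ => ?_
    rw [← measureReal_def, s.uniform_g]
    positivity
  have hgQ : ∀ γ : Fin K → Fin s.L → F, s.μ.real
      ((fun ω k => s.g k ω) ⁻¹' {γ} ∩ (fun ω V => s.Q V ω) ⁻¹' {κ}) ≠ 0 := fun γ => by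
    rw [measureReal_def, s.indep_g_Q.measure_inter_preimage_eq_mul {γ} {κ} trivial trivial,
      ENNReal.toReal_mul]
    exact mul_ne_zero (hg γ) hκ
  choose x hx using fun γ => exists_measureReal_ne_zero (fun ω n => s.X n ω) (hgQ γ)
  have hpos : ∀ {t : Set s.Ω} (γ : Fin K → Fin s.L → F),
      (∀ ω, (fun k => s.g k ω) = γ → (fun V => s.Q V ω) = κ → (fun n => s.X n ω) = x γ → ω ∈ t) →
      s.μ.real t ≠ 0 := fun {t} γ h => by
    refine (lt_of_lt_of_le (measureReal_nonneg.lt_of_ne' (hx γ)) (measureReal_mono ?_)).ne'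
    rintro ω ⟨⟨h1, h2⟩, h3⟩
    exact h ω h1 h2 h3
  let G : (Fin s.L → F) → Fin K → Fin s.L → F := fun v => Pi.single k v
  have hG : ∀ v, ∑ k', G v k' = v := fun v => by simp [G]
  refine le_sum_of_injective (F := F) (fun v n => x (G v) n.1) fun v v' h => ?_
  have hX : ∀ n ∈ U, x (G v) n = x (G v') n := fun n hn => by
    by_cases hnk : n ∈ D k
    · exact congrFun h ⟨n, Finset.mem_inter.2 ⟨hn, hnk⟩⟩
    · have hg0 : ∀ (v : Fin s.L → F) (k' : {k // n ∈ D k}), G v k'.1 = 0 := fun v k' =>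
        Pi.single_eq_of_ne (fun h : k'.1 = k => hnk (h ▸ k'.2)) _
      have hmem : ∀ v ω, (fun k => s.g k ω) = G v → (fun V => s.Q V ω) = κ →
          (fun n => s.X n ω) = x (G v) → ω ∈ (fun ω => (s.X n ω,
            (fun k : {k // n ∈ D k} => s.g k.1 ω,
              fun V : {V : KeyGroup N S // n ∈ V.1} => s.Q V.1 ω))) ⁻¹'
            {(x (G v) n, (fun _ => 0, fun V : {V : KeyGroup N S // n ∈ V.1} => κ V.1))} := by
        intro v ω hg' hQ' hX'
        simp only [Set.mem_preimage, Set.mem_singleton_iff, Prod.mk.injEq]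
        refine ⟨congrFun hX' n, ?_, ?_⟩
        · funext k'
          rw [show s.g k'.1 ω = _ from congrFun hg' k'.1, hg0]
        · funext V
          exact congrFun hQ' V.1
      have hm1 := measurableSet_preimage_pi fun k : {k // n ∈ D k} => s.measurable_g k.1
      have hm2 := measurableSet_preimage_pi
        fun V : {V : KeyGroup N S // n ∈ V.1} => s.measurable_Q V.1
      exact eq_of_condEntropy_eq_zero (s.measurable_X n) (measurableSet_preimage_pair hm1 hm2)
        (s.encodable n) (hpos _ (hmem v)) (hpos _ (hmem v'))
  have hmem : ∀ w, (∀ n ∈ U, x (G v) n = x (G w) n) → ∀ ω, (fun k => s.g k ω) = G w →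
      (fun V => s.Q V ω) = κ → (fun n => s.X n ω) = x (G w) →
      ω ∈ (fun ω => (∑ k, s.g k ω, fun n : U => s.X n.1 ω)) ⁻¹'
        {(w, fun n : U => x (G v) n.1)} := by
    intro w hw ω hg' _ hX'
    simp only [Set.mem_preimage, Set.mem_singleton_iff, Prod.mk.injEq]
    refine ⟨?_, ?_⟩
    · rw [← hG w, ← hg']
    · funext n
      rw [hw n.1 n.2]
      exact congrFun hX' n.1
  have hm1 := measurableSet_preimage_comp (measurableSet_preimage_pi s.measurable_g)
    fun γ : Fin K → Fin s.L → F => ∑ k, γ k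
  have hm2 := measurableSet_preimage_pi fun n : U => s.measurable_X n.1
  exact eq_of_condEntropy_eq_zero hm1 hm2 (s.decodable U hU) (hpos _ (hmem v fun _ _ => rfl))
    (hpos _ (hmem v' hX))

theorem le_of_mem_linearCosts {F : Type*} [Field F] [Fintype F] {K N Nr M : ℕ}
    {D : Fin K → Finset (Fin N)} (hNr : Nr ≤ N) (hM : N < Nr + M) (hD : ∃ k, (D k).card = M)
    {R : ℝ} (hR : R ∈ linearCosts F D Nr) : 1 / ((Nr : ℝ) - N + M) ≤ R := by
  obtain ⟨k, hk⟩ := hD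
  obtain ⟨U, hU, hUD⟩ := exists_users (D k) hNr hM hk
  obtain ⟨s, rfl⟩ := hR
  have h := one_div_card_le_iSup s.L_pos s.len _ (s.L_le k U hU)
  rw [hUD, Nat.cast_sub hM.le] at h
  rwa [Nat.cast_add, add_sub_right_comm] at h

theorem le_of_mem_secureCosts {F : Type*} [Field F] [Fintype F] {K N Nr M S : ℕ}
    {D : Fin K → Finset (Fin N)} (hNr : Nr ≤ N) (hM : N < Nr + M) (hD : ∃ k, (D k).card = M)
    {R : ℝ} (hR : R ∈ secureCosts F D Nr S) : 1 / ((Nr : ℝ) - N + M) ≤ R := by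
  obtain ⟨k, hk⟩ := hD
  obtain ⟨U, hU, hUD⟩ := exists_users (D k) hNr hM hk
  obtain ⟨s, rfl⟩ := hR
  have h := one_div_card_le_iSup s.L_pos s.len _ (s.L_le k U hU)
  rw [hUD, Nat.cast_sub hM.le] at h
  rwa [Nat.cast_add, add_sub_right_comm] at h

/-! ### Achievability -/

theorem pi_uniformOn_univ {ι G : Type*} [Fintype ι] [Fintype G] [Nonempty G] [MeasurableSpace G]
    [MeasurableSingletonClass G] :
    Measure.pi (fun _ : ι => uniformOn (Set.univ : Set G)) = uniformOn Set.univ := by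
  classical
  refine Measure.ext_of_singleton fun γ => ?_
  rw [Measure.pi_singleton]
  simp only [uniformOn_univ, Measure.count_singleton]
  simp [ENNReal.inv_pow]

theorem uniformOn_univ_real_preimage_equiv {G : Type*} [Fintype G] [MeasurableSpace G]
    [MeasurableSingletonClass G] (e : G ≃ G) (s : Set G) :
    (uniformOn (Set.univ : Set G)).real (e ⁻¹' s) = (uniformOn (Set.univ : Set G)).real s := by
  simp only [measureReal_def, uniformOn_univ, Measure.count_apply (Set.toFinite _).measurableSet]
  rw [← Equiv.image_symm_eq_preimage, e.symm.injective.encard_image]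

theorem iIndepFun_comp_measurePreserving {Ω Ω' ι : Type*} {β : ι → Type*}
    [MeasurableSpace Ω] [MeasurableSpace Ω'] {m : ∀ i, MeasurableSpace (β i)} {μ : Measure Ω}
    {μ' : Measure Ω'} {f : ∀ i, Ω → β i} (h : iIndepFun f μ) {T : Ω' → Ω}
    (hT : MeasurePreserving T μ' μ)
    (hf : ∀ i, Measurable (f i)) : iIndepFun (fun i ω => f i (T ω)) μ' := by
  rw [iIndepFun_iff_measure_inter_preimage_eq_mul] at h ⊢
  intro s sets hs
  have h1 := h s hs
  rw [← hT.measure_preimage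
    (Finset.measurableSet_biInter s fun i hi => hf i (hs i hi)).nullMeasurableSet] at h1
  rw [Set.preimage_iInter₂] at h1
  refine h1.trans (Finset.prod_congr rfl fun i hi => ?_)
  rw [← hT.measure_preimage (hf i (hs i hi)).nullMeasurableSet]
  rfl

/-- Messages that are functions `h n` of the sum of the gradients and of masked keys `Q + c g` form
a secure scheme: since the keys are uniform and independent of the gradients, so are the
masked keys. -/
theorem mem_secureCosts {F : Type u} [Field F] [Fintype F] {K N Nr S : ℕ}
    {D : Fin K → Finset (Fin N)} (hN : 0 < N) {L len : ℕ} (hL : 0 < L) {Z : Type u}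
    [Fintype Z] [AddCommGroup Z]
    (h : Fin N → (Fin L → F) → (KeyGroup N S → Z) → (Fin len → F))
    (c : (Fin K → Fin L → F) → KeyGroup N S → Z)
    (henc : ∀ n g g' Q Q', (∀ k, n ∈ D k → g k = g' k) → (∀ V, n ∈ V.1 → Q V = Q' V) →
      h n (∑ k, g k) (Q + c g) = h n (∑ k, g' k) (Q' + c g'))
    (hdec : ∀ U : Finset (Fin N), U.card = Nr → ∀ w w' z z',
      (∀ n ∈ U, h n w z = h n w' z') → w = w') :
    (len : ℝ) / L ∈ secureCosts F D Nr S := by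
  classical
  let _ : MeasurableSpace (Fin L → F) := ⊤
  let _ : MeasurableSpace Z := ⊤
  let P : Measure (Fin K → Fin L → F) := Measure.pi fun _ => uniformOn Set.univ
  let P' : Measure (KeyGroup N S → Z) := Measure.pi fun _ => uniformOn Set.univ
  let g : Fin K → (Fin K → Fin L → F) × (KeyGroup N S → Z) → Fin L → F := fun k ω => ω.1 k
  let Q : KeyGroup N S → (Fin K → Fin L → F) × (KeyGroup N S → Z) → Fin (Fintype.card Z) :=
    fun V ω => Fintype.equivFin Z (ω.2 V)
  let X : Fin N → (Fin K → Fin L → F) × (KeyGroup N S → Z) → Fin len → F :=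
    fun n ω => h n (∑ k, ω.1 k) (ω.2 + c ω.1)
  have hmeas : ∀ s : Set ((Fin K → Fin L → F) × (KeyGroup N S → Z)), MeasurableSet s :=
    fun s => (Set.toFinite s).measurableSet
  have hreal : ∀ k x, (P.prod P').real (g k ⁻¹' {x}) = ((Fintype.card F : ℝ) ^ L)⁻¹ := by
    intro k x
    have h1 := ((measurePreserving_eval (fun _ : Fin K => uniformOn (Set.univ : Set (Fin L → F)))
      k).comp (measurePreserving_fst (μ := P) (ν := P'))).measureReal_preimage
        (s := {x}) (MeasurableSet.singleton x).nullMeasurableSet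
    refine h1.trans ?_
    simp [measureReal_def, uniformOn_univ]
  have hig : iIndepFun (m := fun _ => ⊤) g (P.prod P') :=
    iIndepFun_comp_measurePreserving (iIndepFun_pi (X := fun _ => id)
      fun _ => measurable_id.aemeasurable) measurePreserving_fst fun _ => measurable_pi_apply _
  have hiQ : iIndepFun (m := fun _ => ⊤) Q (P.prod P') :=
    iIndepFun_comp_measurePreserving (iIndepFun_pi (X := fun _ => Fintype.equivFin Z)
      fun _ => measurable_from_top.aemeasurable) measurePreserving_snd
      fun _ => measurable_from_top.comp (measurable_pi_apply _)
  have higQ : @IndepFun _ _ _ _ ⊤ ⊤ (fun ω k => g k ω) (fun ω V => Q V ω) (P.prod P') :=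
    @indepFun_prod _ _ _ _ P P' _ _ _ _ ⊤ ⊤ id (fun z V => Fintype.equivFin Z (z V))
      (fun _ _ => (Set.toFinite _).measurableSet) (fun _ _ => (Set.toFinite _).measurableSet)
  refine ⟨{
    Ω := (Fin K → Fin L → F) × (KeyGroup N S → Z)
    μ := P.prod P'
    L := L
    L_pos := hL
    g := g
    a := fun _ => Fintype.card Z
    Q := Q
    len := fun _ => len
    X := X
    measurable_g := fun _ _ => hmeas _
    measurable_Q := fun _ _ => hmeas _
    measurable_X := fun _ _ => hmeas _
    uniform_g := hreal
    indep_g := hig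
    indep_Q := hiQ
    indep_g_Q := higQ
    encodable := fun n => condEntropy_eq_zero_of_factorsThrough fun ω ω' hω => ?_
    decodable := fun U hU => condEntropy_eq_zero_of_factorsThrough fun ω ω' hω => ?_
    secure := ?_ }, ?_⟩
  · simp only [Prod.mk.injEq] at hω
    refine henc n _ _ _ _ (fun k hk => congrFun hω.1 ⟨k, hk⟩) fun V hV => ?_
    exact (Fintype.equivFin Z).injective (congrFun hω.2 ⟨V, hV⟩)
  · exact hdec U hU _ _ _ _ fun n hn => congrFun hω ⟨n, hn⟩
  · refine condMutualInfo_eq_zero (fun _ => hmeas _) (fun _ => hmeas _) (fun _ => hmeas _)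
      (fun σ x => P'.real ((fun z n => h n σ z) ⁻¹' {x})) (fun σ => ?_) fun x γ σ => ?_
    · rw [sum_measureReal_preimage_singleton _ fun _ _ => (Set.toFinite _).measurableSet]
      simp
    · by_cases hσ : ∑ k, γ k = σ
      · have h1 : (fun ω => ((fun n => X n ω), (fun k => g k ω), ∑ k, g k ω)) ⁻¹' {(x, γ, σ)} =
            {γ} ×ˢ (Equiv.addRight (c γ) ⁻¹' ((fun z n => h n σ z) ⁻¹' {x})) := by
          ext ω
          simp only [Set.mem_preimage, Set.mem_singleton_iff, Prod.mk.injEq, Set.mem_prod, X, g,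
            Equiv.coe_addRight]
          constructor
          · rintro ⟨rfl, rfl, rfl⟩
            exact ⟨rfl, rfl⟩
          · rintro ⟨rfl, rfl⟩
            exact ⟨by rw [hσ], rfl, hσ⟩
        have h2 : (fun ω => ((fun k => g k ω), ∑ k, g k ω)) ⁻¹' {(γ, σ)} =
            {γ} ×ˢ (Set.univ : Set (KeyGroup N S → Z)) := by
          ext ω
          simp only [Set.mem_preimage, Set.mem_singleton_iff, Prod.mk.injEq, Set.mem_prod, g,
            Set.mem_univ, and_true]
          exact ⟨fun h => h.1, fun h => ⟨h, by rw [← hσ, ← h]⟩⟩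
        rw [h1, h2, measureReal_prod_prod, measureReal_prod_prod]
        simp only [P', pi_uniformOn_univ, uniformOn_univ_real_preimage_equiv]
        simp
      · have h1 : (fun ω => ((fun n => X n ω), (fun k => g k ω), ∑ k, g k ω)) ⁻¹' {(x, γ, σ)} =
            ∅ := by
          refine Set.eq_empty_of_forall_notMem fun ω hω => hσ ?_
          simp only [Set.mem_preimage, Set.mem_singleton_iff, Prod.mk.injEq] at hω
          rw [← hω.2.1, hω.2.2]
        have h2 : (fun ω => ((fun k => g k ω), ∑ k, g k ω)) ⁻¹' {(γ, σ)} = ∅ := by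
          refine Set.eq_empty_of_forall_notMem fun ω hω => hσ ?_
          simp only [Set.mem_preimage, Set.mem_singleton_iff, Prod.mk.injEq] at hω
          rw [← hω.1, hω.2]
        rw [h1, h2]
        simp
  · have : Nonempty (Fin N) := ⟨⟨0, hN⟩⟩
    simp [SecureScheme.cost]

/-- An arbitrary `F`-linear identification of the vectors of length `n` over `E` with vectors
over `F`. -/
noncomputable def restrictCoords (F E : Type*) [Field F] [Field E] [Algebra F E]
    [FiniteDimensional F E] (n : ℕ) : (Fin (n * Module.finrank F E) → F) ≃ₗ[F] (Fin n → E) :=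
  LinearEquiv.ofFinrankEq _ _ (by simp [Module.finrank_pi_fintype])

section FromCoefficients

variable {F : Type u} [Field F] {E : Type u} [Field E] [Algebra F E] [FiniteDimensional F E]
  {K N Nr S r A L : ℕ} {D : Fin K → Finset (Fin N)}

/-- The message of server `n` in terms of the gradients assigned to it: all others cancel. -/
theorem Coefficients.sum_add_masked_eq {E : Type*} [Field E] (c : Coefficients E D Nr S r A L)
    (n : Fin N) (v : Fin K → Fin L → E) (z : KeyGroup N S × Fin r → E) :
    c.s1 n *ᵥ (∑ k, v k) + c.s2 n *ᵥ (z + ∑ k, c.C k *ᵥ v k) =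
      (∑ k : {k // n ∈ D k}, (c.s1 n + c.s2 n * c.C k) *ᵥ v k) + c.s2 n *ᵥ z := by
  classical
  have h1 : ∑ k : {k // n ∈ D k}, (c.s1 n + c.s2 n * c.C k) *ᵥ v k =
      ∑ k, (c.s1 n + c.s2 n * c.C k) *ᵥ v k := by
    rw [← Finset.sum_subtype (Finset.univ.filter fun k => n ∈ D k) (by simp)
      (fun k => (c.s1 n + c.s2 n * c.C k) *ᵥ v k), Finset.sum_filter]
    refine Finset.sum_congr rfl fun k _ => ?_
    split_ifs with hk
    · rfl
    · rw [c.cancel k n hk, Matrix.zero_mulVec]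
  rw [h1]
  simp only [Matrix.mulVec_add, Matrix.mulVec_sum, Matrix.add_mulVec, Matrix.mulVec_mulVec,
    Finset.sum_add_distrib]
  abel

theorem Coefficients.mem_secureCosts [Fintype F] (c : Coefficients E D Nr S r A L) (hN : 0 < N)
    (hL : 0 < L) :
    (A : ℝ) / L ∈ secureCosts F D Nr S := by
  have : Finite E := Module.finite_of_finite F
  have := Fintype.ofFinite E
  have he : 0 < Module.finrank F E := Module.finrank_pos
  let β := restrictCoords F E
  have h := GradientCoding.mem_secureCosts (F := F) (D := D) (Nr := Nr) (Z := Fin r → E)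
    (L := L * Module.finrank F E) (len := A * Module.finrank F E) hN (Nat.mul_pos hL he)
    (fun n w z => (β A).symm (c.s1 n *ᵥ β L w + c.s2 n *ᵥ Function.uncurry z))
    (fun g => Function.curry (∑ k, c.C k *ᵥ β L (g k))) ?_ ?_
  · convert h using 1
    push_cast
    rw [mul_div_mul_right]
    exact_mod_cast he.ne'
  · intro n g g' Q Q' hg hQ
    have hu : ∀ (Q : KeyGroup N S → Fin r → E) (v : KeyGroup N S × Fin r → E),
        Function.uncurry (Q + Function.curry v) = Function.uncurry Q + v := fun Q v => rfl
    have hQ' : c.s2 n *ᵥ Function.uncurry Q = c.s2 n *ᵥ Function.uncurry Q' := by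
      funext i
      refine Finset.sum_congr rfl fun x _ => ?_
      by_cases hx : n ∈ x.1.1
      · rw [Function.uncurry_apply_pair, Function.uncurry_apply_pair, hQ x.1 hx]
      · change c.s2 n i x * _ = c.s2 n i x * _
        rw [c.support n i x hx, zero_mul, zero_mul]
    simp only [hu, map_sum]
    rw [c.sum_add_masked_eq, c.sum_add_masked_eq, hQ']
    congr 2
    exact Finset.sum_congr rfl fun k _ => by rw [hg k.1 k.2]
  · intro U hU w w' z z' h
    have h0 := c.decode U hU (β L w - β L w') (Function.uncurry z - Function.uncurry z') ?_
    · exact (β L).injective (sub_eq_zero.1 h0)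
    · intro n hn
      rw [Matrix.mulVec_sub, Matrix.mulVec_sub, sub_add_sub_comm, sub_eq_zero]
      exact (β A).symm.injective (h n hn)

/-- With all keys set to zero, the same coefficients give a linear scheme. -/
theorem Coefficients.mem_linearCosts (c : Coefficients E D Nr S r A L) (hN : 0 < N) (hL : 0 < L) :
    (A : ℝ) / L ∈ linearCosts F D Nr := by
  have he : 0 < Module.finrank F E := Module.finrank_pos
  have hne : Nonempty (Fin N) := ⟨⟨0, hN⟩⟩
  let β := restrictCoords F E
  let enc : (n : Fin N) → ({k // n ∈ D k} → (Fin (L * Module.finrank F E) → F)) →ₗ[F]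
      (Fin (A * Module.finrank F E) → F) := fun n =>
    (β A).symm.toLinearMap ∘ₗ ∑ k : {k // n ∈ D k},
      ((c.s1 n + c.s2 n * c.C k).mulVecLin.restrictScalars F) ∘ₗ (β L).toLinearMap ∘ₗ
        LinearMap.proj k
  have henc : ∀ n (g : Fin K → (Fin (L * Module.finrank F E) → F)), β A (enc n fun k => g k.1) =
      c.s1 n *ᵥ β L (∑ k, g k) + c.s2 n *ᵥ (∑ k, c.C k *ᵥ β L (g k)) := fun n g => by
    have h := c.sum_add_masked_eq n (fun k => β L (g k)) 0
    rw [zero_add, Matrix.mulVec_zero, add_zero] at h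
    rw [map_sum, h]
    simp [enc, Matrix.add_mulVec]
  have hdec : ∀ U : Finset (Fin N), U.card = Nr → Function.FactorsThrough
      (fun g : Fin K → (Fin (L * Module.finrank F E) → F) => ∑ k, g k)
      (fun g (n : U) => enc n.1 fun k => g k.1) := fun U hU g g' h => by
    have h0 := c.decode U hU (β L (∑ k, g k) - β L (∑ k, g' k))
      (∑ k, c.C k *ᵥ β L (g k) - ∑ k, c.C k *ᵥ β L (g' k)) ?_
    · exact (β L).injective (sub_eq_zero.1 h0)
    · intro n hn
      rw [Matrix.mulVec_sub, Matrix.mulVec_sub, sub_add_sub_comm, ← henc, ← henc, sub_eq_zero]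
      exact congrArg _ (congrFun h ⟨n, hn⟩)
  refine ⟨{
    L := L * Module.finrank F E
    L_pos := Nat.mul_pos hL he
    len := fun _ => A * Module.finrank F E
    enc := enc
    decodable := fun U hU => ?_ }, ?_⟩
  · obtain ⟨dec, h⟩ := (Function.factorsThrough_iff _).1 (hdec U hU)
    exact ⟨dec, fun g => (congrFun h g).symm⟩
  · simp only [LinearScheme.cost, ciSup_const]
    push_cast
    rw [mul_div_mul_right]
    exact_mod_cast he.ne'

end FromCoefficients

theorem exists_coefficients_achievableCost (F : Type u) [Field F] {K N Nr M S : ℕ}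
    {D : Fin K → Finset (Fin N)} (hNr : Nr ≤ N) (hM : M ≤ N) (hS : N < Nr + S)
    (hpos : (N - M) * N.choose S < numMeeting N S (N - M) * Nr) (hD : ∀ k, M ≤ (D k).card) :
    ∃ E : IntermediateField F (AlgebraicClosure F), FiniteDimensional F E ∧
      ∃ A L : ℕ, 0 < L ∧ (A : ℝ) / L = achievableCost N Nr M S ∧
        Nonempty (Coefficients E D Nr S (N - M) A L) := by
  obtain ⟨L, hL⟩ := Nat.exists_eq_add_of_le' hpos.le
  obtain ⟨E, hE, c⟩ := exists_coefficients F D hNr (Nat.sub_le N M) hS hL.symm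
    fun k => by have := hD k; omega
  refine ⟨E, hE, _, L, by omega, ?_, c⟩
  have h1 := @numMeeting_add N S (N - M)
  rw [Nat.sub_sub_self hM] at h1
  have h2 : (numMeeting N S (N - M) : ℝ) = N.choose S - M.choose S := by
    rw [← h1]
    push_cast
    ring
  have h3 : (numMeeting N S (N - M) : ℝ) * Nr = L + (N - M) * N.choose S := by
    rw [← Nat.cast_sub hM]
    exact_mod_cast hL
  rw [achievableCost, ← h2, h3]
  congr 1
  ring

/-! ### Evaluation of the cost -/

theorem mul_choose_lt_of_lt {N Nr M S : ℕ} (hMN : M < N) (hSN : S ≤ N) (hM : N < Nr + M)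
    (hS : M < S) : (N - M) * N.choose S < numMeeting N S (N - M) * Nr := by
  rw [numMeeting, Nat.sub_sub_self hMN.le, Nat.choose_eq_zero_of_lt hS, Nat.sub_zero, Nat.mul_comm]
  exact Nat.mul_lt_mul_of_pos_left (by omega) (Nat.choose_pos hSN)

theorem achievableCost_of_lt {N Nr M S : ℕ} (hSN : S ≤ N) (hS : M < S) :
    achievableCost N Nr M S = 1 / ((Nr : ℝ) - N + M) := by
  have h : (N.choose S : ℝ) ≠ 0 := by exact_mod_cast (Nat.choose_pos hSN).ne'
  rw [achievableCost, Nat.choose_eq_zero_of_lt hS]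
  rw [Nat.cast_zero, sub_zero, ← mul_sub, div_mul_eq_div_div, div_self h]
  congr 1
  ring

/-- The bound on the fraction of the groups that lie within `M` given servers, from which
all estimates of the cost for `S ≤ M` follow. -/
theorem choose_fraction_le {N Nr M S : ℕ} (hNr : Nr ≤ N) (hMN : M < N) (hM : N < Nr + M)
    (hS : N + 2 ≤ Nr + S) :
    (Nr : ℝ) * (Nr - 1) * M.choose S ≤
      ((Nr : ℝ) - N + M) * ((Nr : ℝ) - N + M - 1) * N.choose S := by
  obtain ⟨d, rfl⟩ := Nat.exists_eq_add_of_le hNr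
  obtain ⟨x, rfl⟩ := Nat.exists_eq_add_of_le (show d + 1 ≤ M by omega)
  obtain ⟨p, hp⟩ := Nat.exists_eq_add_of_le hMN.le
  have h := choose_ratio (show d + 2 ≤ S by omega) x p
  obtain rfl : Nr = x + p + 1 := by omega
  rw [show d + 1 + (x + p) = x + p + 1 + d by omega] at h
  have h' : ((x : ℝ) + p + 1) * (x + p) * (d + 1 + x).choose S ≤
    (x + 1) * x * (x + p + 1 + d).choose S := by exact_mod_cast h
  push_cast
  convert h' using 2 <;> ring

theorem achievableCost_bounds {N Nr M S : ℕ} (hNr : Nr ≤ N) (hMN : M < N) (hSN : S ≤ N)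
    (hM : N < Nr + M) (hS : N + 2 ≤ Nr + S) :
    ((N : ℝ) - M) * N.choose S < ((N.choose S : ℝ) - M.choose S) * Nr ∧
      1 / ((Nr : ℝ) - N + M) ≤ achievableCost N Nr M S ∧
      achievableCost N Nr M S ≤ 2 * (1 / ((Nr : ℝ) - N + M)) := by
  have h := choose_fraction_le hNr hMN hM hS
  have hB : (0 : ℝ) < N.choose S := by exact_mod_cast Nat.choose_pos hSN
  have hC : (0 : ℝ) ≤ M.choose S := Nat.cast_nonneg _
  have hm : (1 : ℝ) ≤ (Nr : ℝ) - N + M := by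
    have : (N : ℝ) + 1 ≤ Nr + M := by exact_mod_cast hM
    linarith
  have hu : (1 : ℝ) ≤ (N : ℝ) - M := by
    have : (M : ℝ) + 1 ≤ N := by exact_mod_cast hMN
    linarith
  unfold achievableCost
  set B := (N.choose S : ℝ)
  set C := (M.choose S : ℝ)
  obtain ⟨m, hm'⟩ : ∃ m : ℝ, (Nr : ℝ) - N + M = m := ⟨_, rfl⟩
  obtain ⟨u, hu'⟩ : ∃ u : ℝ, (N : ℝ) - M = u := ⟨_, rfl⟩
  have hn : (Nr : ℝ) = m + u := by linarith
  rw [hm'] at h hm ⊢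
  rw [hu'] at hu ⊢
  rw [hn] at h ⊢
  -- `C / B` is at most `m / (m + 2 u)`
  have h2 : (m + 2 * u) * C ≤ m * B := by
    have hpos : 0 < (m + u) * (m + u - 1) := mul_pos (by linarith) (by linarith)
    refine le_of_mul_le_mul_left ?_ hpos
    calc (m + u) * (m + u - 1) * ((m + 2 * u) * C)
        = (m + 2 * u) * ((m + u) * (m + u - 1) * C) := by ring
      _ ≤ (m + 2 * u) * (m * (m - 1) * B) := by gcongr
      _ = m * B * ((m + 2 * u) * (m - 1)) := by ring
      _ ≤ m * B * ((m + u) * (m + u - 1)) := by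
          refine mul_le_mul_of_nonneg_left ?_ (by positivity)
          nlinarith
      _ = _ := by ring
  have h3 : u * B < (B - C) * (m + u) := by
    have h4 : (m + 2 * u) * ((m + u) * C) ≤ (m + u) * (m * B) := by nlinarith
    have h5 : (m + u) * (m * B) < (m + 2 * u) * (m * B) := by
      refine mul_lt_mul_of_pos_right (by linarith) (by positivity)
    have h6 := lt_of_mul_lt_mul_left (h4.trans_lt h5) (by linarith)
    nlinarith
  have hden : 0 < (B - C) * (m + u) - B * u := by linarith
  refine ⟨h3, ?_, ?_⟩
  · rw [div_le_div_iff₀ (by linarith) hden]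
    nlinarith
  · rw [mul_one_div, div_le_div_iff₀ hden (by linarith)]
    nlinarith

end GradientCoding

theorem theorem2 {F : Type*} [Field F] [Fintype F] (K N Nr M S : ℕ)
    (hK : 1 ≤ K) (hNr : Nr ≤ N) (hMN : M < N) (hSN : S ≤ N) (hM : N < Nr + M) :
    -- the optimal linear non-secure cost is `1 / (Nr - N + M)`, for the worst data assignment and
    -- for every single data assignment with minimum replication factor `M`
    (IsLeast (GradientCoding.modelLinearCosts F K N Nr M) (1 / ((Nr : ℝ) - N + M)) ∧
      ∀ D : Fin K → Finset (Fin N), (∀ k, M ≤ (D k).card) → (∃ k, (D k).card = M) →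
        IsLeast (GradientCoding.linearCosts F D Nr) (1 / ((Nr : ℝ) - N + M))) ∧
    -- optimality for `S > M`
    (M < S →
      GradientCoding.achievableCost N Nr M S = 1 / ((Nr : ℝ) - N + M) ∧
      IsLeast (GradientCoding.modelSecureCosts F K N Nr M S)
        (GradientCoding.achievableCost N Nr M S) ∧
      ∀ D : Fin K → Finset (Fin N), (∀ k, M ≤ (D k).card) → (∃ k, (D k).card = M) →
        IsLeast (GradientCoding.secureCosts F D Nr S)
          (GradientCoding.achievableCost N Nr M S)) ∧
    -- order optimality for `N - Nr + 2 ≤ S ≤ M`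
    (N + 2 ≤ Nr + S → S ≤ M →
      GradientCoding.achievableCost N Nr M S ∈ GradientCoding.modelSecureCosts F K N Nr M S ∧
      (∀ R ∈ GradientCoding.modelSecureCosts F K N Nr M S, 1 / ((Nr : ℝ) - N + M) ≤ R) ∧
      (∀ D : Fin K → Finset (Fin N), (∀ k, M ≤ (D k).card) → (∃ k, (D k).card = M) →
        ∀ R ∈ GradientCoding.secureCosts F D Nr S, 1 / ((Nr : ℝ) - N + M) ≤ R) ∧
      1 / ((Nr : ℝ) - N + M) ≤ GradientCoding.achievableCost N Nr M S ∧
      GradientCoding.achievableCost N Nr M S ≤ 2 * (1 / ((Nr : ℝ) - N + M))) := by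
  open GradientCoding in
  have hN : 0 < N := by omega
  -- an assignment with replication factor `M`, which turns lower bounds for single assignments
  -- into lower bounds for the model
  obtain ⟨T, -, hT⟩ := Finset.exists_subset_card_eq
    (show M ≤ (Finset.univ : Finset (Fin N)).card by simpa using hMN.le)
  have hT1 : ∀ k : Fin K, M ≤ ((fun _ => T : Fin K → Finset (Fin N)) k).card := fun _ => hT.ge
  have hT2 : ∃ k : Fin K, ((fun _ => T : Fin K → Finset (Fin N)) k).card = M := ⟨⟨0, hK⟩, hT⟩
  -- linear schemes arise from a single key group containing all servers
  have hlin : 1 / ((Nr : ℝ) - N + M) ∈ modelLinearCosts F K N Nr M := fun D hD => by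
    obtain ⟨E, hE, A, L, hL, hR, ⟨c⟩⟩ := exists_coefficients_achievableCost F hNr hMN.le
      (show N < Nr + N by omega) (mul_choose_lt_of_lt hMN le_rfl hM hMN) hD
    rw [← achievableCost_of_lt le_rfl hMN, ← hR]
    exact c.mem_linearCosts hN hL
  have hsec : N < Nr + S → (N - M) * N.choose S < numMeeting N S (N - M) * Nr →
      achievableCost N Nr M S ∈ modelSecureCosts F K N Nr M S := fun hS hpos D hD => by
    obtain ⟨E, hE, A, L, hL, hR, ⟨c⟩⟩ :=
      exists_coefficients_achievableCost F hNr hMN.le hS hpos hD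
    rw [← hR]
    exact c.mem_secureCosts hN hL
  refine ⟨⟨⟨hlin, fun R hR => le_of_mem_linearCosts hNr hM hT2 (hR _ hT1)⟩, fun D hD hD' =>
    ⟨hlin D hD, fun R hR => le_of_mem_linearCosts hNr hM hD' hR⟩⟩, fun hS => ?_, fun hS _ => ?_⟩
  · have h := hsec (by omega) (mul_choose_lt_of_lt hMN hSN hM hS)
    have hcost := achievableCost_of_lt (Nr := Nr) hSN hS
    refine ⟨hcost, ⟨h, fun R hR => ?_⟩, fun D hD hD' => ⟨h D hD, fun R hR => ?_⟩⟩
    · exact hcost.trans_le (le_of_mem_secureCosts hNr hM hT2 (hR _ hT1))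
    · exact hcost.trans_le (le_of_mem_secureCosts hNr hM hD' hR)
  · obtain ⟨hpos, hlow, hup⟩ := achievableCost_bounds hNr hMN hSN hM hS
    refine ⟨hsec (by omega) ?_, fun R hR => le_of_mem_secureCosts hNr hM hT2 (hR _ hT1),
      fun D _ hD' R hR => le_of_mem_secureCosts hNr hM hD' hR, hlow, hup⟩
    have h1 := @numMeeting_add N S (N - M)
    rw [Nat.sub_sub_self hMN.le] at h1
    rw [← @Nat.cast_lt ℝ]
    push_cast [Nat.cast_sub hMN.le]
    rwa [show (numMeeting N S (N - M) : ℝ) = N.choose S - M.choose S by rw [← h1]; push_cast; ring]
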